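/- For a real matrix $B$ let $J(B)$ be its number of nonzero rows, $r(B)$ its rank and $\|B\|_F$ its Frobenius norm, and let $S(J,r)=\{B\in\mathbb R^{p\times m}: J(B)\le J,\ r(B)\le r\}$. For $X\in\mathbb R^{n\times p}$ put $q=r(X)$ and $$P_o(J,r)=(q\wedge J+m-r)\,r+J\log(ep/J).$$ Let $Y=XB^*+E$, where the entries of $E\in\mathbb R^{n\times m}$ are i.i.d. $\mathcal N(0,\sigma^2)$ with $\sigma>0$. Let $l:[0,\infty)\to[0,\infty)$ be nondecreasing with $l(0)=0$ and $l\not\equiv0$, and let $\delta>0$. Then there are constants $c,c'>0$, depending only on $l$ and on $\delta$, such that the following holds for all $n,p,m,J,r,X,\sigma$ with $p\ge2$, $1\le J\le p/2$, $r(q\wedge J+m-r)\ge16$ and $1\le r\le\min\{(J+m)/2,\,2J,\,2q,\,2m\}$. (i) Suppose that $J\le q$ and that there are $\underline\kappa,\overline\kappa>0$ with $\underline\kappa/\overline\kappa\ge\delta$ such that $$\underline\kappa\|B\|_F^2\le\|XB\|_F^2\le\overline\kappa\|B\|_F^2\qquad(*)$$ for all $B\in\mathbb R^{p\times m}$ with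 $J(B)\le J$ and $r(B)\le r$; in the single case that $J=1$ and $\log(ep)>(m+1-r)r$, suppose moreover that $(*)$ holds for all $B$ with $J(B)\le2$ and $r(B)\le r$. Then $$\inf_{\hat B}\ \sup_{B^*\in S(J,r)}\mathbb E\Big[l\Big(\frac{\|XB^*-X\hat B\|_F^2}{c\,\sigma^2P_o(J,r)}\Big)\Big]\ \ge\ c'.$$ (ii) Suppose that $J>q$ and that $\sigma_{\min}^2(X)/\sigma_{\max}^2(X)\ge\delta$, where $\sigma_{\min}(X)$ and $\sigma_{\max}(X)$ are the smallest and the largest nonzero singular values of $X$. Then $$\inf_{\hat B}\ \sup_{B^*\in S(J,r)}\mathbb E\Big[l\Big(\frac{\|XB^*-X\hat B\|_F^2}{c\,\sigma^2(q+m-r)r}\Big)\Big]\ \ge\ c'.$$ The infima are over all estimators $\hat B=\hat B(Y)\in\mathbb R^{p\times m}$, that is, all measurable functions of $Y$. -/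

import Mathlib

open MeasureTheory ProbabilityTheory

noncomputable section

namespace MinimaxLowRank

/-- The squared Frobenius norm of a real matrix. -/
def frobSq {a b : ℕ} (A : Matrix (Fin a) (Fin b) ℝ) : ℝ :=
  ∑ i, ∑ k, A i k ^ 2

open Classical in
/-- The number `J(B)` of nonzero rows of a matrix. -/
def numNonzeroRows {p m : ℕ} (B : Matrix (Fin p) (Fin m) ℝ) : ℕ :=
  (Finset.univ.filter fun j : Fin p => ∃ k, B j k ≠ 0).card

/-- The signal class `S(J, r)`: at most `J` nonzero rows and rank at most `r`. -/
def signalClass (p m J r : ℕ) : Set (Matrix (Fin p) (Fin m) ℝ) :=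
  {B | numNonzeroRows B ≤ J ∧ B.rank ≤ r}

/-- The complexity `P_o(J, r) = (q ∧ J + m - r) r + J log (e p / J)`. -/
def Po (q p m J r : ℕ) : ℝ :=
  (((min q J : ℕ) : ℝ) + m - r) * r + J * Real.log (Real.exp 1 * p / J)

/-- `κ₁ ‖B‖_F² ≤ ‖X B‖_F² ≤ κ₂ ‖B‖_F²` for every `p × m` matrix `B` with at most `s` nonzero rows
and rank at most `r`. -/
def RestrictedBounds {n p : ℕ} (X : Matrix (Fin n) (Fin p) ℝ) (m s r : ℕ) (κ₁ κ₂ : ℝ) : Prop :=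
  ∀ B ∈ signalClass p m s r,
    κ₁ * frobSq B ≤ frobSq (X * B) ∧ frobSq (X * B) ≤ κ₂ * frobSq B

/-- The largest singular value (singular values are listed in nonincreasing order from index 0). -/
def sigmaMax {n p : ℕ} (X : Matrix (Fin n) (Fin p) ℝ) : ℝ :=
  (Matrix.toEuclideanLin X).singularValues 0

/-- The smallest nonzero singular value, the one with index `rank X - 1` (and `0` if `X = 0`). -/
def sigmaMin {n p : ℕ} (X : Matrix (Fin n) (Fin p) ℝ) : ℝ :=
  (Matrix.toEuclideanLin X).singularValues (X.rank - 1)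

/-- The law of an `n × m` noise matrix with i.i.d. `N(0, σ²)` entries, given as a function of the
row and column indices. -/
def noiseLaw (n m : ℕ) (σ : ℝ) : Measure (Fin n → Fin m → ℝ) :=
  Measure.pi fun _ => Measure.pi fun _ => gaussianReal 0 (Real.toNNReal (σ ^ 2))

/-- The expected loss `E[l(‖X B - X B̂(Y)‖_F² / s)]`, where `Y = X B + E` and `E` has i.i.d.
`N(0, σ²)` entries. -/
def risk {n p m : ℕ} (l : ℝ → ℝ) (X : Matrix (Fin n) (Fin p) ℝ) (σ s : ℝ)
    (Bhat : (Fin n → Fin m → ℝ) → (Fin p → Fin m → ℝ)) (B : Matrix (Fin p) (Fin m) ℝ) : ENNReal :=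
  ∫⁻ E, ENNReal.ofReal (l (frobSq (X * B - X * Matrix.of (Bhat (X * B + Matrix.of E))) / s))
    ∂(noiseLaw n m σ)

/-- The minimax risk over `S(J, r)`: the infimum over all estimators, that is, all measurable
functions of the `n × m` data matrix `Y` with values in the `p × m` matrices, of the supremum of
the expected loss over the signal class. -/
def minimaxRisk {n p : ℕ} (m J r : ℕ) (l : ℝ → ℝ) (X : Matrix (Fin n) (Fin p) ℝ) (σ s : ℝ) :
    ENNReal :=
  ⨅ (Bhat : (Fin n → Fin m → ℝ) → (Fin p → Fin m → ℝ)) (_ : Measurable Bhat),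
    ⨆ B ∈ signalClass p m J r, risk l X σ s Bhat B

end MinimaxLowRank

end

noncomputable section

namespace MinimaxLowRank

/-! The lower bound is Bayesian. Take signals `B ω` indexed by all words `ω` of length `d` over `b ≥
2` letters, and let `κ = d log b` be the logarithm of their number. Scale them so that `‖X B ω‖² ≤
σ² κ / 32`, while `‖X B ω - X B ω'‖²` is at least a multiple of the Hamming distance. A single
estimate can be close to the images of those words only that lie in one Hamming ball of radius `d /
8`, and such a ball holds at most `e^(7κ/8)` of the `e^κ` words (`card_hamming_ball_le`). Under pure
noise the events "the estimate is close to `X B ω`" therefore have average probability at most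
`e^(-κ/8)`. The second moment of the likelihood ratio, at most `e^(κ/32)`, carries this over to the
laws with signal (`noiseLaw_shift_le`, `exists_shift_prob_le`), so for some word the estimate is far
with probability bounded below. The whole cube of words serves; no separated subset is extracted.

Two families give the two terms of the rate. Binary matrices in an `a × b` block with `min a b ≤ r`
give the dimension term (`le_minimaxRisk_of_block`); one row chosen out of each of `s` blocks of
rows gives the logarithmic term (`le_minimaxRisk_of_support`). In (i) the family of the larger term
is used. In (ii) only the dimension term occurs, and the block is placed so that `X` acts on it
isometrically (`exists_orthonormal_mul`). -/

/-! ### Gaussian shifts and change of measure -/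

/-- A product of measures with densities has the product density. -/
theorem pi_withDensity_eq {ι : Type*} [Fintype ι] {α : ι → Type*} [∀ i, MeasurableSpace (α i)]
    (μ ν : ∀ i, Measure (α i)) [∀ i, IsProbabilityMeasure (μ i)]
    [∀ i, IsProbabilityMeasure (ν i)] (f : ∀ i, α i → ENNReal) (hf : ∀ i, Measurable (f i))
    (h : ∀ i, ν i = (μ i).withDensity (f i)) :
    Measure.pi ν = (Measure.pi μ).withDensity fun x => ∏ i, f i (x i) := by
  refine Measure.pi_eq fun s hs => ?_
  rw [withDensity_apply _ (MeasurableSet.univ_pi hs), ← lintegral_indicator (.univ_pi hs)]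
  have hind : ∀ x, (Set.univ.pi s).indicator (fun x => ∏ i, f i (x i)) x
      = ∏ i, (s i).indicator (f i) (x i) := by
    intro x
    by_cases hx : x ∈ Set.univ.pi s
    · rw [Set.indicator_of_mem hx]
      exact Finset.prod_congr rfl fun i _ =>
        (Set.indicator_of_mem (hx i (Set.mem_univ i)) _).symm
    · rw [Set.indicator_of_notMem hx]
      simp only [Set.mem_pi, Set.mem_univ, true_implies, not_forall] at hx
      obtain ⟨i, hi⟩ := hx
      exact (Finset.prod_eq_zero (Finset.mem_univ i) (Set.indicator_of_notMem hi _)).symm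
  have hm : ∀ i, Measurable ((s i).indicator (f i)) := fun i => (hf i).indicator (hs i)
  simp_rw [hind]
  -- Coordinates are independent under the product law, so the integral over a box factors.
  rw [lintegral_prod_eq_prod_lintegral_of_indepFun Finset.univ
    (fun i (x : ∀ i, α i) => (s i).indicator (f i) (x i))
    (iIndepFun_pi fun i => (hm i).aemeasurable)
    (fun i => (hm i).comp (measurable_pi_apply i))]
  refine Finset.prod_congr rfl fun i _ => ?_
  have := (measurePreserving_eval μ i).lintegral_comp (hm i)
  simp only [Function.eval] at this
  rw [this, lintegral_indicator (hs i), h i, withDensity_apply _ (hs i)]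

theorem gaussianReal_eq_withDensity {v : NNReal} (hv : v ≠ 0) (a : ℝ) :
    gaussianReal a v = (gaussianReal 0 v).withDensity
      fun x => ENNReal.ofReal (Real.exp (a * x / v - a ^ 2 / (2 * v))) := by
  have hv' : (v : ℝ) ≠ 0 := by exact_mod_cast hv
  rw [gaussianReal_of_var_ne_zero _ hv, gaussianReal_of_var_ne_zero _ hv,
    ← withDensity_mul _ (measurable_gaussianPDF 0 v) (by fun_prop)]
  congr 1
  ext x
  rw [Pi.mul_apply, gaussianPDF, gaussianPDF,
    ← ENNReal.ofReal_mul (gaussianPDFReal_nonneg _ _ _), gaussianPDFReal, gaussianPDFReal,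
    mul_assoc (Real.sqrt _)⁻¹, ← Real.exp_add]
  congr 3
  field_simp
  ring

/-- The likelihood ratio between the Gaussian noise shifted by `θ` and the centred noise. -/
def likelihoodRatio {n m : ℕ} (σ : ℝ) (θ x : Fin n → Fin m → ℝ) : ENNReal :=
  ∏ i, ∏ k, ENNReal.ofReal (Real.exp (θ i k * x i k / σ ^ 2 - θ i k ^ 2 / (2 * σ ^ 2)))

theorem measurable_likelihoodRatio {n m : ℕ} (σ : ℝ) (θ : Fin n → Fin m → ℝ) :
    Measurable (likelihoodRatio σ θ) := by
  unfold likelihoodRatio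
  fun_prop

instance (n m : ℕ) (σ : ℝ) : IsProbabilityMeasure (noiseLaw n m σ) := by
  unfold noiseLaw
  infer_instance

theorem pi_map_const_add {ι : Type*} [Fintype ι] {α : ι → Type*} [∀ i, MeasurableSpace (α i)]
    [∀ i, Add (α i)] [∀ i, MeasurableAdd (α i)] (μ ν : ∀ i, Measure (α i))
    [∀ i, IsProbabilityMeasure (ν i)] (a : ∀ i, α i)
    (h : ∀ i, (μ i).map (fun x => a i + x) = ν i) :
    (Measure.pi μ).map (fun x => a + x) = Measure.pi ν := by
  have : ∀ i, SigmaFinite ((μ i).map (fun x => a i + x)) := fun i => by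
    rw [h]; infer_instance
  refine (Measure.pi_map_pi (f := fun i x => a i + x)
    (fun i => (measurable_const_add (a i)).aemeasurable)).trans ?_
  simp_rw [h]

theorem gaussianReal_map_const_add_eq (v : NNReal) (a : ℝ) :
    (gaussianReal 0 v).map (fun x => a + x) = gaussianReal a v := by
  have := gaussianReal_map_add_const (μ := 0) (v := v) a
  simp only [add_comm _ a, add_zero] at this
  exact this

theorem noiseLaw_map_add {n m : ℕ} {σ : ℝ} (hσ : 0 < σ) (θ : Fin n → Fin m → ℝ) :
    (noiseLaw n m σ).map (fun x => θ + x) = (noiseLaw n m σ).withDensity (likelihoodRatio σ θ) := by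
  have hv : Real.toNNReal (σ ^ 2) ≠ 0 := by
    rw [Ne, Real.toNNReal_eq_zero, not_le]; positivity
  have hc : ((Real.toNNReal (σ ^ 2) : NNReal) : ℝ) = σ ^ 2 := Real.coe_toNNReal _ (sq_nonneg σ)
  unfold noiseLaw
  generalize Real.toNNReal (σ ^ 2) = v at hv hc
  have hmap : (Measure.pi fun _ : Fin n => Measure.pi fun _ : Fin m => gaussianReal 0 v).map
      (fun x => θ + x) = Measure.pi fun i => Measure.pi fun k => gaussianReal (θ i k) v :=
    pi_map_const_add _ _ θ fun i => pi_map_const_add _ _ (θ i) fun k =>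
      gaussianReal_map_const_add_eq v (θ i k)
  have hrow : ∀ i, Measure.pi (fun k => gaussianReal (θ i k) v)
      = (Measure.pi fun _ : Fin m => gaussianReal 0 v).withDensity fun x =>
        ∏ k, ENNReal.ofReal (Real.exp (θ i k * x k / σ ^ 2 - θ i k ^ 2 / (2 * σ ^ 2))) := by
    intro i
    refine pi_withDensity_eq (fun _ : Fin m => gaussianReal 0 v) _ (fun k x => ENNReal.ofReal
      (Real.exp (θ i k * x / σ ^ 2 - θ i k ^ 2 / (2 * σ ^ 2)))) (fun i => by fun_prop) fun k => ?_
    rw [gaussianReal_eq_withDensity hv, hc]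
  rw [hmap]
  exact pi_withDensity_eq (fun _ : Fin n => Measure.pi fun _ : Fin m => gaussianReal 0 v)
    (fun i => Measure.pi fun k => gaussianReal (θ i k) v) (fun i x => ∏ k, ENNReal.ofReal
    (Real.exp (θ i k * x k / σ ^ 2 - θ i k ^ 2 / (2 * σ ^ 2)))) (fun i => by fun_prop) hrow

theorem lintegral_likelihoodRatio {n m : ℕ} {σ : ℝ} (hσ : 0 < σ) (θ : Fin n → Fin m → ℝ) :
    ∫⁻ x, likelihoodRatio σ θ x ∂(noiseLaw n m σ) = 1 := by
  have h := congrArg (fun μ => μ Set.univ) (noiseLaw_map_add hσ θ)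
  rw [withDensity_apply _ MeasurableSet.univ, Measure.restrict_univ,
    Measure.map_apply (measurable_const_add θ) MeasurableSet.univ] at h
  simpa using h.symm

/-- Squaring doubles the linear part of the exponent, whereas the ratio at `2 • θ` has four times
the quadratic part; the surplus is the exponential factor. As the ratio at `2 • θ` integrates to
one, that factor is the second moment. -/
theorem likelihoodRatio_sq {n m : ℕ} {σ : ℝ} (θ x : Fin n → Fin m → ℝ) :
    likelihoodRatio σ θ x ^ 2
      = ENNReal.ofReal (Real.exp (frobSq (Matrix.of θ) / σ ^ 2))
        * likelihoodRatio σ (2 • θ) x := by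
  unfold likelihoodRatio frobSq
  simp_rw [← ENNReal.ofReal_prod_of_nonneg (fun _ _ => (Real.exp_pos _).le), ← Real.exp_sum]
  rw [← ENNReal.ofReal_prod_of_nonneg (fun _ _ => (Real.exp_pos _).le),
    ← ENNReal.ofReal_prod_of_nonneg (fun _ _ => (Real.exp_pos _).le), ← Real.exp_sum,
    ← Real.exp_sum, ← ENNReal.ofReal_pow (Real.exp_pos _).le,
    ← ENNReal.ofReal_mul (Real.exp_pos _).le, ← Real.exp_add, ← Real.exp_nat_mul]
  congr 2
  rw [Finset.sum_div, Finset.mul_sum, ← Finset.sum_add_distrib]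
  refine Finset.sum_congr rfl fun i _ => ?_
  rw [Finset.sum_div, Finset.mul_sum, ← Finset.sum_add_distrib]
  refine Finset.sum_congr rfl fun k _ => ?_
  simp only [Pi.smul_apply, Matrix.of_apply, nsmul_eq_mul]
  push_cast
  ring

/-- Change of measure: the probability of a set under shifted Gaussian noise, bounded by its
probability under the centred noise and the second moment of the likelihood ratio. -/
theorem noiseLaw_shift_le {n m : ℕ} {σ : ℝ} (hσ : 0 < σ) (θ : Fin n → Fin m → ℝ) {τ : ℝ}
    (hτ : 0 < τ) {A : Set (Fin n → Fin m → ℝ)} (hA : MeasurableSet A) :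
    2 * (noiseLaw n m σ) ((fun x => θ + x) ⁻¹' A)
      ≤ ENNReal.ofReal (τ * Real.exp (frobSq (Matrix.of θ) / σ ^ 2))
        + ENNReal.ofReal τ⁻¹ * noiseLaw n m σ A := by
  rw [← Measure.map_apply (measurable_const_add θ) hA, noiseLaw_map_add hσ,
    withDensity_apply _ hA, ← lintegral_indicator hA,
    ← lintegral_const_mul _ ((measurable_likelihoodRatio σ θ).indicator hA)]
  -- The inequality `2y ≤ τy² + τ⁻¹` on `A`; the free `τ` balances the two terms later.
  have hmain : ∀ x, 2 * A.indicator (likelihoodRatio σ θ) x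
      ≤ ENNReal.ofReal τ * likelihoodRatio σ θ x ^ 2 + ENNReal.ofReal τ⁻¹ * A.indicator 1 x := by
    intro x
    by_cases hx : x ∈ A
    · rw [Set.indicator_of_mem hx, Set.indicator_of_mem hx]
      have hfin : likelihoodRatio σ θ x ≠ ⊤ := by
        unfold likelihoodRatio
        exact ENNReal.prod_ne_top fun i _ => ENNReal.prod_ne_top fun k _ => ENNReal.ofReal_ne_top
      obtain ⟨y, hy, hxy⟩ : ∃ y : ℝ, 0 ≤ y ∧ likelihoodRatio σ θ x = ENNReal.ofReal y :=
        ⟨_, ENNReal.toReal_nonneg, (ENNReal.ofReal_toReal hfin).symm⟩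
      rw [hxy, ← ENNReal.ofReal_pow hy, ← ENNReal.ofReal_mul hτ.le, Pi.one_apply, mul_one,
        ← ENNReal.ofReal_add (by positivity) (by positivity), ← ENNReal.ofReal_ofNat,
        ← ENNReal.ofReal_mul (by norm_num)]
      apply ENNReal.ofReal_le_ofReal
      have h : τ * y ^ 2 + τ⁻¹ - 2 * y = τ⁻¹ * (τ * y - 1) ^ 2 := by
        field_simp
        ring
      have : 0 ≤ τ⁻¹ * (τ * y - 1) ^ 2 := by positivity
      linarith
    · simp [Set.indicator_of_notMem hx]
  refine (lintegral_mono hmain).trans (le_of_eq ?_)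
  have hm1 : Measurable fun x => likelihoodRatio σ θ x ^ 2 :=
    (measurable_likelihoodRatio σ θ).pow_const 2
  rw [lintegral_add_left (hm1.const_mul _), lintegral_const_mul _ hm1,
    lintegral_const_mul _ (measurable_one.indicator hA), lintegral_indicator_one hA]
  simp_rw [likelihoodRatio_sq]
  rw [lintegral_const_mul _ (measurable_likelihoodRatio _ _), lintegral_likelihoodRatio hσ,
    mul_one, ENNReal.ofReal_mul hτ.le]

/-! ### Counting words in Hamming balls -/

/-- The sum factors over positions: at each one, a single letter agrees (weight `1`) and `b - 1`
letters differ (weight `a`). -/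
theorem sum_pow_hammingDist {ι : Type*} [Fintype ι] [DecidableEq ι] {b : ℕ} (ω : ι → Fin b)
    (a : ℝ) : ∑ ω' : ι → Fin b, a ^ hammingDist ω ω'
      = (1 + ((b : ℝ) - 1) * a) ^ Fintype.card ι := by
  have h1 : ∀ ω' : ι → Fin b, a ^ hammingDist ω ω' = ∏ i, if ω i ≠ ω' i then a else 1 := by
    intro ω'
    rw [Finset.prod_ite, Finset.prod_const, Finset.prod_const_one, mul_one, hammingDist]
  have h2 : ∀ i, ∑ x : Fin b, (if ω i ≠ x then a else 1) = 1 + ((b : ℝ) - 1) * a := by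
    intro i
    rw [← Finset.add_sum_erase _ _ (Finset.mem_univ (ω i))]
    have : ∀ x ∈ Finset.univ.erase (ω i), (if ω i ≠ x then a else 1) = a := fun x hx =>
      if_pos (Finset.ne_of_mem_erase hx).symm
    rw [Finset.sum_congr rfl this, Finset.sum_const, Finset.card_erase_of_mem (Finset.mem_univ _),
      Finset.card_univ, Fintype.card_fin, nsmul_eq_mul,
      Nat.cast_sub (Nat.one_le_of_lt (ω i).isLt)]
    simp
  simp_rw [h1]
  have h3 := Finset.prod_univ_sum (fun _ : ι => (Finset.univ : Finset (Fin b)))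
    (fun i x => if ω i ≠ x then a else 1)
  rw [Fintype.piFinset_univ] at h3
  rw [← h3]
  simp_rw [h2]
  rw [Finset.prod_const, Finset.card_univ]

theorem one_add_le_exp_log {b : ℕ} (hb : 2 ≤ b) :
    1 + ((b : ℝ) - 1) * (b : ℝ)⁻¹ ≤ Real.exp (3 / 4 * Real.log b) := by
  have hb' : (2 : ℝ) ≤ b := by exact_mod_cast hb
  have hb0 : (0 : ℝ) < b := by linarith
  -- Fourth powers reduce `2 - 1/b ≤ b^(3/4)` to `(2b - 1)^4 ≤ b^7`. For `b ≥ 3` the crude bound `16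
  -- ≤ b^3` suffices; `b = 2` is checked by hand.
  have hpow : (1 + ((b : ℝ) - 1) * (b : ℝ)⁻¹) ^ 4 ≤ Real.exp (3 / 4 * Real.log b) ^ 4 := by
    have h3 : Real.exp (3 / 4 * Real.log b) ^ 4 = (b : ℝ) ^ 3 := by
      rw [← Real.exp_nat_mul, ← Real.exp_log hb0, ← Real.exp_nat_mul, Real.log_exp]
      congr 1
      push_cast
      ring
    rw [h3]
    have h4 : 1 + ((b : ℝ) - 1) * (b : ℝ)⁻¹ = (2 * b - 1) / b := by
      field_simp
      ring
    rw [h4, div_pow, div_le_iff₀ (by positivity), ← pow_add]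
    rcases Nat.lt_or_ge b 3 with h | h
    · obtain rfl : b = 2 := by omega
      norm_num
    · have hb3 : (3 : ℝ) ≤ b := by exact_mod_cast h
      calc (2 * (b : ℝ) - 1) ^ 4 ≤ (2 * b) ^ 4 :=
            pow_le_pow_left₀ (by linarith) (by linarith) 4
        _ = 16 * b ^ 4 := by ring
        _ ≤ (b : ℝ) ^ 3 * b ^ 4 := by
            gcongr
            calc (16 : ℝ) ≤ 3 ^ 3 := by norm_num
              _ ≤ (b : ℝ) ^ 3 := by gcongr
        _ = (b : ℝ) ^ (3 + 4) := by ring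
  exact le_of_pow_le_pow_left₀ (by norm_num) (Real.exp_pos _).le hpow

/-- A Hamming ball whose radius is an eighth of the length contains a small share of all words. -/
theorem card_hamming_ball_le {ι : Type*} [Fintype ι] [DecidableEq ι] {b : ℕ} (hb : 2 ≤ b)
    (ω : ι → Fin b) :
    ((Finset.univ.filter fun ω' => 8 * hammingDist ω ω' ≤ Fintype.card ι).card : ℝ)
      ≤ Real.exp (7 / 8 * (Fintype.card ι * Real.log b)) := by
  have hb' : (2 : ℝ) ≤ b := by exact_mod_cast hb
  have hb0 : (0 : ℝ) < b := by linarith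
  have hlog : 0 ≤ Real.log b := Real.log_nonneg (by linarith)
  set d : ℝ := ((Fintype.card ι : ℕ) : ℝ) with hd
  -- Markov's inequality with weight `b^(-distance)`: each word of the ball weighs at least
  -- `b^(-d/8)`, all words together at most `b^(3d/4)`.
  have hterm : ∀ ω' ∈ Finset.univ.filter (fun ω' => 8 * hammingDist ω ω' ≤ Fintype.card ι),
      Real.exp (-(1 / 8 * (d * Real.log b))) ≤ ((b : ℝ)⁻¹) ^ hammingDist ω ω' := by
    intro ω' h
    have h8 : (8 : ℝ) * hammingDist ω ω' ≤ d := by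
      rw [hd]
      exact_mod_cast (Finset.mem_filter.1 h).2
    rw [← Real.exp_log hb0, ← Real.exp_neg, ← Real.exp_nat_mul, Real.log_exp]
    apply Real.exp_le_exp.2
    nlinarith
  have hsum : ((Finset.univ.filter fun ω' => 8 * hammingDist ω ω' ≤ Fintype.card ι).card : ℝ)
      * Real.exp (-(1 / 8 * (d * Real.log b))) ≤ Real.exp (3 / 4 * (d * Real.log b)) := by
    calc _ ≤ ∑ ω' ∈ Finset.univ.filter (fun ω' => 8 * hammingDist ω ω' ≤ Fintype.card ι),
            ((b : ℝ)⁻¹) ^ hammingDist ω ω' := by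
          rw [← nsmul_eq_mul]
          exact Finset.card_nsmul_le_sum _ _ _ hterm
      _ ≤ ∑ ω', ((b : ℝ)⁻¹) ^ hammingDist ω ω' :=
          Finset.sum_le_sum_of_subset_of_nonneg (Finset.subset_univ _)
            fun _ _ _ => by positivity
      _ = (1 + ((b : ℝ) - 1) * (b : ℝ)⁻¹) ^ Fintype.card ι := sum_pow_hammingDist _ _
      _ ≤ Real.exp (3 / 4 * Real.log b) ^ Fintype.card ι := by
          have : 0 ≤ ((b : ℝ) - 1) * (b : ℝ)⁻¹ := mul_nonneg (by linarith) (by positivity)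
          exact pow_le_pow_left₀ (by linarith) (one_add_le_exp_log hb) _
      _ = Real.exp (3 / 4 * (d * Real.log b)) := by
          rw [← Real.exp_nat_mul]
          congr 1
          rw [hd]
          ring
  rw [Real.exp_neg, ← div_eq_mul_inv, div_le_iff₀ (Real.exp_pos _), ← Real.exp_add] at hsum
  refine hsum.trans (le_of_eq ?_)
  congr 1
  ring

/-! ### From families of words to minimax bounds -/

theorem frobSq_sub_le {a b : ℕ} (A C Z : Matrix (Fin a) (Fin b) ℝ) :
    frobSq (A - C) ≤ 2 * frobSq (A - Z) + 2 * frobSq (C - Z) := by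
  unfold frobSq
  rw [Finset.mul_sum, Finset.mul_sum, ← Finset.sum_add_distrib]
  refine Finset.sum_le_sum fun i _ => ?_
  rw [Finset.mul_sum, Finset.mul_sum, ← Finset.sum_add_distrib]
  refine Finset.sum_le_sum fun k _ => ?_
  simp only [Matrix.sub_apply]
  nlinarith [sq_nonneg (A i k - Z i k + (C i k - Z i k))]

/-- Bayesian bound: sets of which no point lies in too many cannot all be likely under the
correspondingly shifted noise. -/
theorem exists_shift_prob_le {Ω : Type*} [Fintype Ω] [Nonempty Ω] {n m : ℕ} {σ : ℝ} (hσ : 0 < σ)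
    (θ : Ω → Fin n → Fin m → ℝ) (A : Ω → Set (Fin n → Fin m → ℝ))
    (hA : ∀ ω, MeasurableSet (A ω)) {κ : ℝ} (hcard : (Fintype.card Ω : ℝ) = Real.exp κ)
    (hθ : ∀ ω, frobSq (Matrix.of (θ ω)) / σ ^ 2 ≤ κ / 32)
    (hN : ∀ y, (Nat.card {ω // y ∈ A ω} : ℝ) ≤ Real.exp (7 / 8 * κ)) :
    ∃ ω, (noiseLaw n m σ).real ((fun x => θ ω + x) ⁻¹' A ω) ≤ Real.exp (-(κ / 32)) := by
  classical
  have hκ : 0 ≤ κ := by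
    have : (1 : ℝ) ≤ Fintype.card Ω := by exact_mod_cast Fintype.card_pos
    rw [hcard] at this
    simpa using this
  -- Exchange of sum and integral: the sum of the probabilities is the mean number of sets that
  -- contain the noise.
  have hsumA : ∑ ω, (noiseLaw n m σ).real (A ω) ≤ Real.exp (7 / 8 * κ) := by
    have h1 : ∑ ω, noiseLaw n m σ (A ω) ≤ ENNReal.ofReal (Real.exp (7 / 8 * κ)) := by
      calc ∑ ω, noiseLaw n m σ (A ω)
          = ∑ ω, ∫⁻ y, (A ω).indicator 1 y ∂(noiseLaw n m σ) :=
            Finset.sum_congr rfl fun ω _ => (lintegral_indicator_one (hA ω)).symm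
        _ = ∫⁻ y, ∑ ω, (A ω).indicator 1 y ∂(noiseLaw n m σ) :=
            (lintegral_finsetSum _ fun ω _ => measurable_one.indicator (hA ω)).symm
        _ ≤ ∫⁻ _, ENNReal.ofReal (Real.exp (7 / 8 * κ)) ∂(noiseLaw n m σ) := by
            refine lintegral_mono fun y => ?_
            have h2 : ∑ ω, (A ω).indicator (1 : (Fin n → Fin m → ℝ) → ENNReal) y
                = (Nat.card {ω // y ∈ A ω} : ENNReal) := by
              simp only [Set.indicator_apply, Pi.one_apply, Finset.sum_boole]
              rw [Nat.card_eq_fintype_card, Fintype.card_subtype]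
            simp only [h2]
            rw [← ENNReal.ofReal_natCast]
            exact ENNReal.ofReal_le_ofReal (hN y)
        _ = _ := by simp
    have h3 := ENNReal.toReal_mono ENNReal.ofReal_ne_top h1
    rw [ENNReal.toReal_sum fun _ _ => measure_ne_top _ _,
      ENNReal.toReal_ofReal (Real.exp_pos _).le] at h3
    exact h3
  have hreal : ∀ ω, 2 * (noiseLaw n m σ).real ((fun x => θ ω + x) ⁻¹' A ω)
      ≤ Real.exp (-(κ / 32)) + Real.exp (κ / 16) * (noiseLaw n m σ).real (A ω) := by
    intro ω
    -- With `τ = e^(-κ/16)` the first term is at most `e^(-κ/32)`, and the second averages to at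
    -- most `e^(κ/16 - κ/8) ≤ e^(-κ/32)`.
    have h1 := noiseLaw_shift_le hσ (θ ω) (Real.exp_pos (-(κ / 16))) (hA ω)
    have h2 := ENNReal.toReal_mono (by finiteness) h1
    rw [ENNReal.toReal_mul, ENNReal.toReal_add (by finiteness) (by finiteness),
      ENNReal.toReal_mul, ENNReal.toReal_ofReal (by positivity),
      ENNReal.toReal_ofReal (by positivity), ← Real.exp_add, ← Real.exp_neg, neg_neg] at h2
    refine h2.trans (add_le_add_left (Real.exp_le_exp.2 ?_) _)
    linarith [hθ ω]
  obtain ⟨ω, -, hω⟩ : ∃ ω ∈ (Finset.univ : Finset Ω),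
      (noiseLaw n m σ).real ((fun x => θ ω + x) ⁻¹' A ω) ≤ Real.exp (-(κ / 32)) := by
    refine Finset.exists_le_of_sum_le Finset.univ_nonempty ?_
    have h1 := Finset.sum_le_sum fun ω (_ : ω ∈ (Finset.univ : Finset Ω)) => hreal ω
    rw [← Finset.mul_sum, Finset.sum_add_distrib, ← Finset.mul_sum] at h1
    have h2 : Real.exp (κ / 16) * ∑ ω, (noiseLaw n m σ).real (A ω)
        ≤ ∑ _ω : Ω, Real.exp (-(κ / 32)) := by
      calc _ ≤ Real.exp (κ / 16) * Real.exp (7 / 8 * κ) := by gcongr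
        _ = Real.exp (κ / 16 + 7 / 8 * κ) := (Real.exp_add _ _).symm
        _ ≤ Real.exp (κ + -(κ / 32)) := Real.exp_le_exp.2 (by linarith)
        _ = ∑ _ω : Ω, Real.exp (-(κ / 32)) := by
            rw [Finset.sum_const, Finset.card_univ, nsmul_eq_mul, hcard, Real.exp_add]
    linarith
  exact ⟨ω, hω⟩

/-- Minimax lower bound from a family of signals that is indexed by words and whose images are
separated in Hamming distance. -/
theorem le_minimaxRisk_of_words {n p m J r : ℕ} {l : ℝ → ℝ} (hmono : MonotoneOn l (Set.Ici 0))
    {t : ℝ} (ht : 0 ≤ t) (hlt : 0 ≤ l t) (X : Matrix (Fin n) (Fin p) ℝ) {σ : ℝ} (hσ : 0 < σ)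
    {ι : Type*} [Fintype ι] [Nonempty ι] {b : ℕ} (hb : 2 ≤ b)
    (B : (ι → Fin b) → Matrix (Fin p) (Fin m) ℝ) (hmem : ∀ ω, B ω ∈ signalClass p m J r)
    {v : ℝ} (hv : 0 < v)
    (hsep : ∀ ω ω', v * hammingDist ω ω' ≤ frobSq (X * B ω - X * B ω'))
    (hup : ∀ ω, frobSq (X * B ω) ≤ σ ^ 2 * (Fintype.card ι * Real.log b / 32))
    {s : ℝ} (hs : 0 < s) (hscale : 32 * (t * s) ≤ v * Fintype.card ι) :
    ENNReal.ofReal (l t * (1 - Real.exp (-(Real.log 2 / 32)))) ≤ minimaxRisk m J r l X σ s := by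
  classical
  refine le_iInf₂ fun Bhat hB => ?_
  have : Nonempty (ι → Fin b) := ⟨fun _ => ⟨0, by omega⟩⟩
  have hb0 : (0 : ℝ) < b := by positivity
  set Z : (Fin n → Fin m → ℝ) → Matrix (Fin n) (Fin m) ℝ := fun y => X * Matrix.of (Bhat y) with hZ
  have hentry : ∀ (M : Matrix (Fin n) (Fin m) ℝ), Measurable fun y => frobSq (M - Z y) := by
    intro M
    unfold frobSq
    simp only [hZ, Matrix.sub_apply, Matrix.mul_apply, Matrix.of_apply]
    fun_prop
  set A : (ι → Fin b) → Set (Fin n → Fin m → ℝ) := fun ω =>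
    {y | frobSq (X * B ω - Z y) < t * s} with hAdef
  have hA : ∀ ω, MeasurableSet (A ω) := fun ω => measurableSet_lt (hentry _) measurable_const
  set κ : ℝ := Fintype.card ι * Real.log b with hκ
  have hcard : (Fintype.card (ι → Fin b) : ℝ) = Real.exp κ := by
    rw [Fintype.card_fun, Fintype.card_fin, hκ, Real.exp_nat_mul, Real.exp_log hb0]
    push_cast
    rfl
  have hN : ∀ y, (Nat.card {ω // y ∈ A ω} : ℝ) ≤ Real.exp (7 / 8 * κ) := by
    intro y
    rw [Nat.card_eq_fintype_card, Fintype.card_subtype]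
    rcases (Finset.univ.filter fun ω => y ∈ A ω).eq_empty_or_nonempty with h | ⟨ω, hω⟩
    · rw [h]
      simp [(Real.exp_pos _).le]
    · refine le_trans ?_ (card_hamming_ball_le hb ω)
      norm_cast
      refine Finset.card_le_card fun ω' hω' => ?_
      simp only [Finset.mem_filter, Finset.mem_univ, true_and, hAdef, Set.mem_ofPred_eq]
        at hω hω' ⊢
      have h1 := frobSq_sub_le (X * B ω) (X * B ω') (Z y)
      have h2 := hsep ω ω'
      -- Two images within `t * s` of `Z y` are within `4 * t * s` of each other (squared norms),
      -- whence the factor `32 = 8 * 4` in `hscale`.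
      have h3 : v * (8 * hammingDist ω ω') ≤ v * Fintype.card ι := by linarith
      exact_mod_cast le_of_mul_le_mul_left h3 hv
  set θ : (ι → Fin b) → Fin n → Fin m → ℝ := fun ω i k => (X * B ω) i k with hθdef
  have hθ : ∀ ω, frobSq (Matrix.of (θ ω)) / σ ^ 2 ≤ κ / 32 := by
    intro ω
    rw [show Matrix.of (θ ω) = X * B ω from rfl, div_le_iff₀ (by positivity), mul_comm]
    exact hup ω
  obtain ⟨ω, hω⟩ := exists_shift_prob_le hσ θ A hA hcard hθ hN
  refine le_trans ?_ (le_iSup₂ (f := fun B _ => risk l X σ s Bhat B) (B ω) (hmem ω))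
  set A' : Set (Fin n → Fin m → ℝ) := (fun x => θ ω + x) ⁻¹' A ω with hA'
  have hA'm : MeasurableSet A' := measurable_const_add (θ ω) (hA ω)
  have hrisk : ENNReal.ofReal (l t) * noiseLaw n m σ A'ᶜ ≤ risk l X σ s Bhat (B ω) := by
    unfold risk
    rw [← lintegral_indicator_const hA'm.compl]
    refine lintegral_mono fun x => ?_
    by_cases hx : x ∈ A'
    · simp [hx]
    · rw [Set.indicator_of_mem hx]
      have hle : t ≤ frobSq (X * B ω - X * Matrix.of (Bhat (X * B ω + Matrix.of x))) / s :=
        (le_div_iff₀ hs).2 (not_lt.1 hx)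
      exact ENNReal.ofReal_le_ofReal (hmono ht (ht.trans hle) hle)
  refine le_trans ?_ hrisk
  rw [ENNReal.ofReal_mul hlt]
  gcongr
  rw [← ofReal_measureReal]
  apply ENNReal.ofReal_le_ofReal
  rw [probReal_compl_eq_one_sub hA'm]
  -- The least possible `κ` makes the probability bound uniform in all dimensions.
  have hlog : Real.log 2 ≤ κ := by
    have h1 : Real.log 2 ≤ Real.log b := Real.log_le_log (by norm_num) (by exact_mod_cast hb)
    have h2 : (1 : ℝ) ≤ Fintype.card ι := by exact_mod_cast Fintype.card_pos
    have h3 : 0 ≤ Real.log 2 := Real.log_nonneg (by norm_num)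
    nlinarith
  have hexp : Real.exp (-(κ / 32)) ≤ Real.exp (-(Real.log 2 / 32)) :=
    Real.exp_le_exp.2 (by linarith)
  linarith

theorem frobSq_smul {a b : ℕ} (c : ℝ) (A : Matrix (Fin a) (Fin b) ℝ) :
    frobSq (c • A) = c ^ 2 * frobSq A := by
  simp [frobSq, Finset.mul_sum, mul_pow]

theorem frobSq_eq_trace {a b : ℕ} (A : Matrix (Fin a) (Fin b) ℝ) :
    frobSq A = (A.transpose * A).trace := by
  simp only [frobSq, Matrix.trace, Matrix.diag_apply, Matrix.mul_apply, Matrix.transpose_apply]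
  rw [Finset.sum_comm]
  simp only [sq]

theorem frobSq_transpose {a b : ℕ} (A : Matrix (Fin a) (Fin b) ℝ) :
    frobSq A.transpose = frobSq A := by
  simp only [frobSq, Matrix.transpose_apply]
  exact Finset.sum_comm

theorem frobSq_orthonormal_mul {a b d : ℕ} {U : Matrix (Fin a) (Fin b) ℝ}
    (hU : U.transpose * U = 1) (W : Matrix (Fin b) (Fin d) ℝ) : frobSq (U * W) = frobSq W := by
  rw [frobSq_eq_trace, frobSq_eq_trace, Matrix.transpose_mul, Matrix.mul_assoc,
    ← Matrix.mul_assoc _ U, hU, Matrix.one_mul]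

theorem frobSq_mul_orthonormal {a b d : ℕ} {Q : Matrix (Fin b) (Fin d) ℝ}
    (hQ : Q * Q.transpose = 1) (W : Matrix (Fin a) (Fin b) ℝ) : frobSq (W * Q) = frobSq W := by
  rw [← frobSq_transpose, Matrix.transpose_mul, frobSq_orthonormal_mul, frobSq_transpose]
  rwa [Matrix.transpose_transpose]

theorem numNonzeroRows_smul_le {p m : ℕ} (c : ℝ) (B : Matrix (Fin p) (Fin m) ℝ) :
    numNonzeroRows (c • B) ≤ numNonzeroRows B := by
  classical
  unfold numNonzeroRows
  refine Finset.card_le_card fun j hj => ?_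
  simp only [Finset.mem_filter, Finset.mem_univ, true_and] at hj ⊢
  obtain ⟨k, hk⟩ := hj
  exact ⟨k, fun h => hk (by simp [h])⟩

theorem numNonzeroRows_mul_le {p a m : ℕ} (G : Matrix (Fin p) (Fin a) ℝ)
    (W : Matrix (Fin a) (Fin m) ℝ) : numNonzeroRows (G * W) ≤ numNonzeroRows G := by
  classical
  unfold numNonzeroRows
  refine Finset.card_le_card fun j hj => ?_
  simp only [Finset.mem_filter, Finset.mem_univ, true_and] at hj ⊢
  by_contra h
  push Not at h
  obtain ⟨k, hk⟩ := hj
  exact hk (by simp [Matrix.mul_apply, h])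

theorem rank_smul_le {p m : ℕ} (c : ℝ) (B : Matrix (Fin p) (Fin m) ℝ) :
    (c • B).rank ≤ B.rank := by
  rw [show c • B = (c • (1 : Matrix (Fin p) (Fin p) ℝ)) * B by
    rw [Matrix.smul_mul, Matrix.one_mul]]
  exact Matrix.rank_mul_le_right _ _

theorem smul_mem_signalClass {p m J r : ℕ} (c : ℝ) {B : Matrix (Fin p) (Fin m) ℝ}
    (hB : B ∈ signalClass p m J r) : c • B ∈ signalClass p m J r :=
  ⟨(numNonzeroRows_smul_le c B).trans hB.1, (rank_smul_le c B).trans hB.2⟩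

/-- Minimax lower bound from a family of words whose normalised images satisfy two-sided bounds
in terms of the Hamming distance and the length. -/
theorem le_minimaxRisk_of_unit_words {n p m J r : ℕ} {l : ℝ → ℝ}
    (hmono : MonotoneOn l (Set.Ici 0)) {t : ℝ} (ht : 0 ≤ t) (hlt : 0 ≤ l t)
    (X : Matrix (Fin n) (Fin p) ℝ) {σ : ℝ} (hσ : 0 < σ)
    {ι : Type*} [Fintype ι] [Nonempty ι] {b : ℕ} (hb : 2 ≤ b)
    (B : (ι → Fin b) → Matrix (Fin p) (Fin m) ℝ) (hmem : ∀ ω, B ω ∈ signalClass p m J r)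
    {κ₁ κ₂ δ : ℝ} (h₁ : 0 < κ₁) (h₂ : 0 < κ₂) (hδ : δ ≤ κ₁ / κ₂)
    (hsep : ∀ ω ω', κ₁ * hammingDist ω ω' ≤ frobSq (X * (B ω - B ω')))
    (hup : ∀ ω, frobSq (X * B ω) ≤ κ₂ * Fintype.card ι)
    {s : ℝ} (hs : 0 < s)
    (hscale : 1024 * (t * s) ≤ δ * (σ ^ 2 * (Fintype.card ι * Real.log b))) :
    ENNReal.ofReal (l t * (1 - Real.exp (-(Real.log 2 / 32)))) ≤ minimaxRisk m J r l X σ s := by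
  have hlog : 0 < Real.log b := Real.log_pos (by exact_mod_cast hb)
  -- The largest squared scale that the energy constraint allows; the separation then carries `κ₁ /
  -- κ₂`, and `1024 = 32 * 32`.
  set g : ℝ := σ ^ 2 * Real.log b / (32 * κ₂) with hg
  have hg0 : 0 < g := by positivity
  have hsq : Real.sqrt g ^ 2 = g := Real.sq_sqrt hg0.le
  refine le_minimaxRisk_of_words hmono ht hlt X hσ hb (fun ω => Real.sqrt g • B ω)
    (fun ω => smul_mem_signalClass _ (hmem ω)) (v := g * κ₁) (by positivity) ?_ ?_ hs ?_
  · intro ω ω'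
    rw [← Matrix.mul_sub, ← smul_sub, Matrix.mul_smul, frobSq_smul, hsq, mul_assoc]
    exact mul_le_mul_of_nonneg_left (hsep ω ω') hg0.le
  · intro ω
    rw [Matrix.mul_smul, frobSq_smul, hsq]
    refine (mul_le_mul_of_nonneg_left (hup ω) hg0.le).trans (le_of_eq ?_)
    rw [hg]
    field_simp
  · have h3 : δ * (σ ^ 2 * (Fintype.card ι * Real.log b))
        ≤ κ₁ / κ₂ * (σ ^ 2 * (Fintype.card ι * Real.log b)) := by gcongr
    have h4 : g * κ₁ * Fintype.card ι
        = κ₁ / κ₂ * (σ ^ 2 * (Fintype.card ι * Real.log b)) / 32 := by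
      rw [hg]
      field_simp
    rw [h4]
    linarith

/-! ### The dimension term: blocks of free entries -/

/-- The inclusion of the first `a` of `p` coordinates, as a matrix. -/
def coordInclusion {a p : ℕ} (h : a ≤ p) : Matrix (Fin p) (Fin a) ℝ :=
  (1 : Matrix (Fin p) (Fin p) ℝ).submatrix id (Fin.castLE h)

theorem coordInclusion_transpose_mul {a p : ℕ} (h : a ≤ p) :
    (coordInclusion h).transpose * coordInclusion h = 1 := by
  ext i k
  simp [coordInclusion, Matrix.mul_apply, Matrix.one_apply]

theorem numNonzeroRows_coordInclusion_le {a p : ℕ} (h : a ≤ p) :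
    numNonzeroRows (coordInclusion h) ≤ a := by
  classical
  unfold numNonzeroRows
  calc _ ≤ (Finset.univ.image (Fin.castLE h)).card := by
        refine Finset.card_le_card fun j hj => ?_
        simp only [Finset.mem_filter, Finset.mem_univ, true_and] at hj
        obtain ⟨k, hk⟩ := hj
        refine Finset.mem_image.2 ⟨k, Finset.mem_univ _, ?_⟩
        by_contra hne
        exact hk (by simp [coordInclusion, Ne.symm hne])
    _ ≤ a := Finset.card_image_le.trans (by simp)

theorem hammingDist_le_frobSq {a b : ℕ} (ω ω' : Fin a × Fin b → Fin 2) :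
    (hammingDist ω ω' : ℝ) ≤ frobSq ((Matrix.of fun i k => ((ω (i, k) : ℕ) : ℝ))
      - Matrix.of fun i k => ((ω' (i, k) : ℕ) : ℝ)) := by
  unfold frobSq hammingDist
  rw [← Fintype.sum_prod_type', Finset.card_filter]
  push_cast
  refine Finset.sum_le_sum fun x _ => ?_
  rcases x with ⟨i, k⟩
  simp only [Matrix.sub_apply, Matrix.of_apply]
  generalize ω (i, k) = u
  generalize ω' (i, k) = w
  fin_cases u <;> fin_cases w <;> simp

theorem frobSq_word_le {a b : ℕ} (ω : Fin a × Fin b → Fin 2) :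
    frobSq (Matrix.of fun i k => ((ω (i, k) : ℕ) : ℝ)) ≤ Fintype.card (Fin a × Fin b) := by
  unfold frobSq
  rw [← Fintype.sum_prod_type', ← Finset.card_univ, Finset.cast_card]
  refine Finset.sum_le_sum fun x _ => ?_
  rcases x with ⟨i, k⟩
  simp only [Matrix.of_apply]
  generalize ω (i, k) = u
  fin_cases u <;> simp

/-- Minimax lower bound by the dimension `a * b` of a block of free entries. -/
theorem le_minimaxRisk_of_block {n p m J r : ℕ} {l : ℝ → ℝ}
    (hmono : MonotoneOn l (Set.Ici 0)) {t : ℝ} (ht : 0 ≤ t) (hlt : 0 ≤ l t)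
    (X : Matrix (Fin n) (Fin p) ℝ) {σ : ℝ} (hσ : 0 < σ)
    {a b : ℕ} (ha : 0 < a) (hb : 0 < b) (hbm : b ≤ m) (hr : min a b ≤ r)
    (G : Matrix (Fin p) (Fin a) ℝ) (hG : numNonzeroRows G ≤ J)
    {κ₁ κ₂ δ : ℝ} (h₁ : 0 < κ₁) (h₂ : 0 < κ₂) (hδ : δ ≤ κ₁ / κ₂)
    (hX : ∀ W : Matrix (Fin a) (Fin m) ℝ, W.rank ≤ r →
      κ₁ * frobSq W ≤ frobSq (X * (G * W)) ∧ frobSq (X * (G * W)) ≤ κ₂ * frobSq W)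
    {s : ℝ} (hs : 0 < s)
    (hscale : 1024 * (t * s) ≤ δ * (σ ^ 2 * ((a * b : ℕ) * Real.log 2))) :
    ENNReal.ofReal (l t * (1 - Real.exp (-(Real.log 2 / 32)))) ≤ minimaxRisk m J r l X σ s := by
  have : Nonempty (Fin a × Fin b) := ⟨(⟨0, ha⟩, ⟨0, hb⟩)⟩
  set Q := (coordInclusion hbm).transpose with hQdef
  have hQ : Q * Q.transpose = 1 := by
    rw [hQdef, Matrix.transpose_transpose, coordInclusion_transpose_mul]
  set V : (Fin a × Fin b → Fin 2) → Matrix (Fin a) (Fin b) ℝ := fun ω =>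
    Matrix.of fun i k => ((ω (i, k) : ℕ) : ℝ) with hV
  have hrank : ∀ M : Matrix (Fin a) (Fin b) ℝ, (M * Q).rank ≤ r := fun M => by
    refine le_trans ?_ hr
    refine (Matrix.rank_mul_le_left M Q).trans (le_min ?_ ?_)
    · simpa using M.rank_le_height
    · simpa using M.rank_le_width
  refine le_minimaxRisk_of_unit_words hmono ht hlt X hσ le_rfl (fun ω => G * (V ω * Q)) ?_
    h₁ h₂ hδ ?_ ?_ hs ?_
  · exact fun ω => ⟨(numNonzeroRows_mul_le _ _).trans hG,
      (Matrix.rank_mul_le_right _ _).trans (hrank _)⟩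
  · intro ω ω'
    rw [← Matrix.mul_sub, ← Matrix.sub_mul]
    refine le_trans ?_ (hX _ (hrank _)).1
    rw [frobSq_mul_orthonormal hQ]
    exact mul_le_mul_of_nonneg_left (hammingDist_le_frobSq ω ω') h₁.le
  · intro ω
    refine (hX _ (hrank _)).2.trans ?_
    rw [frobSq_mul_orthonormal hQ]
    exact mul_le_mul_of_nonneg_left (frobSq_word_le ω) h₂.le
  · simpa using hscale

/-- Some `X * G` has orthonormal columns, where `G` has at most `rank X` nonzero rows. -/
theorem exists_orthonormal_mul {n p : ℕ} (X : Matrix (Fin n) (Fin p) ℝ) {a : ℕ}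
    (ha : a ≤ X.rank) : ∃ G : Matrix (Fin p) (Fin a) ℝ,
      numNonzeroRows G ≤ X.rank ∧ (X * G).transpose * (X * G) = 1 := by
  classical
  set e := (WithLp.linearEquiv 2 ℝ (Fin n → ℝ)).symm with he
  set c : Fin p → EuclideanSpace ℝ (Fin n) := fun j => e (X.col j) with hc
  -- A maximal independent family of columns. An orthonormal basis of the column space is expanded
  -- in these columns alone, so the coefficient matrix is supported on `rank X` rows.
  obtain ⟨κ, f, hf, hspan, hli⟩ := exists_linearIndependent' ℝ c
  have : Finite κ := Finite.of_injective f hf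
  have : Fintype κ := Fintype.ofFinite κ
  set S := Submodule.span ℝ (Set.range (c ∘ f)) with hS
  have hfin : Module.finrank ℝ S = X.rank := by
    rw [hspan, Matrix.rank_eq_finrank_span_cols, hc,
      show (fun j => e (X.col j)) = e ∘ X.col from rfl, Set.range_comp, ← LinearEquiv.coe_coe,
      ← Submodule.map_span]
    exact LinearEquiv.finrank_map_eq e _
  have hκ : Fintype.card κ = X.rank := by rw [← hfin, hS, finrank_span_eq_card hli]
  set u := stdOrthonormalBasis ℝ S with hu
  have hmem : ∀ k, ∃ w : κ → ℝ, ∑ i, w i • (c ∘ f) i = (u k : EuclideanSpace ℝ (Fin n)) :=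
    fun k => (Submodule.mem_span_range_iff_exists_fun ℝ).1 (u k).2
  choose w hw using hmem
  have ha' : a ≤ Module.finrank ℝ S := ha.trans hfin.ge
  refine ⟨Matrix.of fun j k => ∑ i, if f i = j then w (Fin.castLE ha' k) i else 0, ?_, ?_⟩
  · unfold numNonzeroRows
    calc _ ≤ (Finset.univ.image f).card := by
          refine Finset.card_le_card fun j hj => ?_
          obtain ⟨k, hk⟩ := (Finset.mem_filter.1 hj).2
          obtain ⟨i, -, hi⟩ := Finset.exists_ne_zero_of_sum_ne_zero hk
          refine Finset.mem_image.2 ⟨i, Finset.mem_univ _, ?_⟩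
          by_contra hne
          exact hi (if_neg hne)
      _ ≤ X.rank := Finset.card_image_le.trans (by rw [Finset.card_univ, hκ])
  · have hcol : ∀ i k, (X * Matrix.of fun j (k : Fin a) =>
        ∑ i, if f i = j then w (Fin.castLE ha' k) i else 0) i k
        = (u (Fin.castLE ha' k) : EuclideanSpace ℝ (Fin n)) i := by
      intro i k
      rw [← hw, Matrix.mul_apply]
      simp only [Matrix.of_apply, Finset.mul_sum]
      rw [Finset.sum_comm]
      simp [hc, he, mul_comm, WithLp.ofLp_sum]
    ext k k'
    rw [Matrix.mul_apply]
    simp only [Matrix.transpose_apply, hcol]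
    have horth := orthonormal_iff_ite.1 u.orthonormal (Fin.castLE ha' k) (Fin.castLE ha' k')
    rw [Submodule.coe_inner, PiLp.inner_apply] at horth
    simp only [RCLike.inner_apply, conj_trivial] at horth
    rw [Matrix.one_apply]
    simp only [Fin.castLE_inj] at horth
    rw [← horth]
    exact Finset.sum_congr rfl fun i _ => mul_comm _ _

/-! ### The logarithmic term: choice of the support -/

theorem RestrictedBounds.mono {n p m s s' r : ℕ} {X : Matrix (Fin n) (Fin p) ℝ} {κ₁ κ₂ : ℝ}
    (h : RestrictedBounds X m s r κ₁ κ₂) (hs : s' ≤ s) : RestrictedBounds X m s' r κ₁ κ₂ :=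
  fun B hB => h B ⟨hB.1.trans hs, hB.2⟩

/-- The indicator vector of the graph of a word. -/
def graphIndicator {s b p : ℕ} (f : Fin s × Fin b ↪ Fin p) (ω : Fin s → Fin b) (j : Fin p) : ℝ :=
  if j ∈ Finset.univ.map ⟨fun i => f (i, ω i), fun i i' h => by
    simpa using congrArg Prod.fst (f.injective h)⟩ then 1 else 0

theorem graphIndicator_apply {s b p : ℕ} (f : Fin s × Fin b ↪ Fin p) (ω : Fin s → Fin b)
    (i : Fin s) (x : Fin b) : graphIndicator f ω (f (i, x)) = if ω i = x then 1 else 0 := by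
  unfold graphIndicator
  refine if_congr ?_ rfl rfl
  rw [Finset.mem_map]
  constructor
  · rintro ⟨i', -, h⟩
    have hi := Prod.mk.inj (f.injective h)
    rw [← hi.1]
    exact hi.2
  · rintro rfl
    exact ⟨i, Finset.mem_univ i, rfl⟩

theorem card_graphIndicator_ne_zero {s b p : ℕ} (f : Fin s × Fin b ↪ Fin p) (ω : Fin s → Fin b) :
    (Finset.univ.filter fun j => graphIndicator f ω j ≠ 0).card = s := by
  unfold graphIndicator
  simp only [ne_eq, ite_eq_right_iff, one_ne_zero, imp_false, not_not,
    Finset.filter_univ_mem, Finset.card_map, Finset.card_univ, Fintype.card_fin]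

theorem sum_graphIndicator_sq {s b p : ℕ} (f : Fin s × Fin b ↪ Fin p) (ω : Fin s → Fin b) :
    ∑ j, graphIndicator f ω j ^ 2 = s := by
  unfold graphIndicator
  simp only [ite_pow, one_pow, ne_eq, OfNat.ofNat_ne_zero, not_false_eq_true, zero_pow,
    Finset.sum_boole, Finset.filter_univ_mem, Finset.card_map, Finset.card_univ, Fintype.card_fin]

/-- Each position of disagreement contributes `1` at the point of the first graph over it; points
off that graph are dropped. -/
theorem hammingDist_le_sum_graphIndicator {s b p : ℕ} (f : Fin s × Fin b ↪ Fin p)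
    (ω ω' : Fin s → Fin b) :
    (hammingDist ω ω' : ℝ) ≤ ∑ j, (graphIndicator f ω j - graphIndicator f ω' j) ^ 2 := by
  have hinj : Function.Injective fun i => f (i, ω i) := fun i i' h => by
    simpa using congrArg Prod.fst (f.injective h)
  calc (hammingDist ω ω' : ℝ)
      ≤ ∑ i, (graphIndicator f ω (f (i, ω i)) - graphIndicator f ω' (f (i, ω i))) ^ 2 := by
        rw [hammingDist, Finset.card_filter]
        push_cast
        refine Finset.sum_le_sum fun i _ => ?_
        rw [graphIndicator_apply, graphIndicator_apply, if_pos rfl]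
        by_cases h : ω i = ω' i
        · simp [h]
        · simp [h, Ne.symm h]
    _ = ∑ j ∈ Finset.univ.map ⟨_, hinj⟩, (graphIndicator f ω j - graphIndicator f ω' j) ^ 2 := by
        rw [Finset.sum_map]
        rfl
    _ ≤ _ := Finset.sum_le_sum_of_subset_of_nonneg (Finset.subset_univ _)
        fun _ _ _ => sq_nonneg _

theorem frobSq_vecMulVec_single {p m : ℕ} (x : Fin p → ℝ) (k : Fin m) :
    frobSq (Matrix.vecMulVec x (Pi.single k 1)) = ∑ j, x j ^ 2 := by
  unfold frobSq
  refine Finset.sum_congr rfl fun j _ => ?_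
  simp [Matrix.vecMulVec_apply, Pi.single_apply]

theorem vecMulVec_single_mem_signalClass {p m J r : ℕ} {x : Fin p → ℝ} (k : Fin m)
    (hx : (Finset.univ.filter fun j => x j ≠ 0).card ≤ J) (hr : 1 ≤ r) :
    Matrix.vecMulVec x (Pi.single k 1) ∈ signalClass p m J r := by
  classical
  refine ⟨le_trans ?_ hx, (Matrix.rank_vecMulVec_le _ _).trans hr⟩
  unfold numNonzeroRows
  refine Finset.card_le_card fun j hj => ?_
  obtain ⟨k', hk'⟩ := (Finset.mem_filter.1 hj).2
  refine Finset.mem_filter.2 ⟨Finset.mem_univ _, fun h => hk' ?_⟩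
  simp [Matrix.vecMulVec_apply, h]

/-- Minimax lower bound by the entropy `s * log b` of the choice of `s` rows, one out of each of
`s` blocks of `b` rows. -/
theorem le_minimaxRisk_of_support {n p m J r : ℕ} {l : ℝ → ℝ}
    (hmono : MonotoneOn l (Set.Ici 0)) {t : ℝ} (ht : 0 ≤ t) (hlt : 0 ≤ l t)
    (X : Matrix (Fin n) (Fin p) ℝ) {σ : ℝ} (hσ : 0 < σ)
    {s b : ℕ} (hs : 0 < s) (hb : 2 ≤ b) (hp : s * b ≤ p) (hsJ : s ≤ J) (hm : 0 < m) (hr : 1 ≤ r)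
    {κ₁ κ₂ δ : ℝ} (h₁ : 0 < κ₁) (h₂ : 0 < κ₂) (hδ : δ ≤ κ₁ / κ₂)
    (hX : RestrictedBounds X m (2 * s) r κ₁ κ₂) {S : ℝ} (hS : 0 < S)
    (hscale : 1024 * (t * S) ≤ δ * (σ ^ 2 * (s * Real.log b))) :
    ENNReal.ofReal (l t * (1 - Real.exp (-(Real.log 2 / 32)))) ≤ minimaxRisk m J r l X σ S := by
  classical
  have : Nonempty (Fin s) := ⟨⟨0, hs⟩⟩
  set k : Fin m := ⟨0, hm⟩
  set f : Fin s × Fin b ↪ Fin p := finProdFinEquiv.toEmbedding.trans (Fin.castLEEmb hp)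
  refine le_minimaxRisk_of_unit_words hmono ht hlt X hσ hb
    (fun ω => Matrix.vecMulVec (graphIndicator f ω) (Pi.single k 1)) (fun ω => ?_) h₁ h₂ hδ
    (fun ω ω' => ?_) (fun ω => ?_) hS (by simpa using hscale)
  · exact vecMulVec_single_mem_signalClass k ((card_graphIndicator_ne_zero f ω).trans_le hsJ) hr
  · have hsub : Matrix.vecMulVec (graphIndicator f ω) (Pi.single k 1)
        - Matrix.vecMulVec (graphIndicator f ω') (Pi.single k 1)
        = Matrix.vecMulVec (graphIndicator f ω - graphIndicator f ω') (Pi.single k (1 : ℝ)) :=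
      (Matrix.sub_vecMulVec _ _ _).symm
    -- A difference lives on the union of two supports, hence the restricted bounds for `2 * s`
    -- rows.
    have hcard : (Finset.univ.filter fun j =>
        (graphIndicator f ω - graphIndicator f ω') j ≠ 0).card ≤ 2 * s := by
      calc _ ≤ ((Finset.univ.filter fun j => graphIndicator f ω j ≠ 0)
            ∪ Finset.univ.filter fun j => graphIndicator f ω' j ≠ 0).card := by
            refine Finset.card_le_card fun j hj => ?_
            simp only [Finset.mem_filter, Finset.mem_univ, true_and, Finset.mem_union,
              Pi.sub_apply] at hj ⊢
            by_contra h
            push Not at h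
            exact hj (by rw [h.1, h.2, sub_zero])
        _ ≤ _ := Finset.card_union_le _ _
        _ = 2 * s := by
            rw [card_graphIndicator_ne_zero, card_graphIndicator_ne_zero, two_mul]
    rw [hsub]
    refine le_trans ?_ (hX _ (vecMulVec_single_mem_signalClass k hcard hr)).1
    rw [frobSq_vecMulVec_single]
    exact mul_le_mul_of_nonneg_left (hammingDist_le_sum_graphIndicator f ω ω') h₁.le
  · refine (hX _ (vecMulVec_single_mem_signalClass k ?_ hr)).2.trans ?_
    · rw [card_graphIndicator_ne_zero]
      omega
    · rw [frobSq_vecMulVec_single, sum_graphIndicator_sq, Fintype.card_fin]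

/-! ### Choice of block sizes -/

theorem half_lt_log_two : (1 / 2 : ℝ) < Real.log 2 := by
  linarith [Real.log_two_gt_d9]

/-- The summand `log e = 1` is absorbed by `1 ≤ 2 log 2 ≤ 2 log b`. -/
theorem log_exp_one_mul_le {x b : ℝ} (hx : 0 < x) (hb : 2 ≤ b) (hxb : x ≤ b) :
    Real.log (Real.exp 1 * x) ≤ 3 * Real.log b := by
  rw [Real.log_mul (Real.exp_pos 1).ne' hx.ne', Real.log_exp]
  have h1 : Real.log x ≤ Real.log b := Real.log_le_log hx hxb
  have h2 : Real.log 2 ≤ Real.log b := Real.log_le_log (by norm_num) hb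
  linarith [half_lt_log_two]

/-- Block dimensions for which the number of free entries is comparable with `(K + m - r) * r`. -/
theorem exists_block {K m r : ℕ} (hr : 1 ≤ r) (hK : r ≤ 2 * K) (hm : r ≤ 2 * m) :
    ∃ a b : ℕ, 0 < a ∧ 0 < b ∧ a ≤ K ∧ b ≤ m ∧ min a b ≤ r ∧
      ((K : ℝ) + m - r) * r ≤ 8 * ((a * b : ℕ) * Real.log 2) := by
  have hlog := half_lt_log_two
  -- The term `-r²` is dropped, and `log 2 > 1/2` turns the factor `4` into `8`. The longer side of
  -- the block is kept whole and the other is cut down to `r`, which costs at most a factor `2`.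
  suffices h : ∃ a b : ℕ, 0 < a ∧ 0 < b ∧ a ≤ K ∧ b ≤ m ∧ min a b ≤ r ∧
      (K + m) * r ≤ 4 * (a * b) by
    obtain ⟨a, b, ha, hb, haK, hbm, hab, h⟩ := h
    refine ⟨a, b, ha, hb, haK, hbm, hab, ?_⟩
    have h1 : ((K : ℝ) + m) * r ≤ 4 * ((a * b : ℕ) : ℝ) := by exact_mod_cast h
    have h2 : (0 : ℝ) ≤ (r : ℝ) * r := by positivity
    have h3 : (0 : ℝ) ≤ ((a * b : ℕ) : ℝ) := by positivity
    nlinarith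
  rcases le_total m K with h | h
  · refine ⟨K, min r m, by omega, by omega, le_rfl, by omega, by omega, ?_⟩
    have : r ≤ 2 * min r m := by omega
    calc (K + m) * r ≤ (2 * K) * (2 * min r m) := Nat.mul_le_mul (by omega) this
      _ = 4 * (K * min r m) := by ring
  · refine ⟨min r K, m, by omega, by omega, by omega, le_rfl, by omega, ?_⟩
    have : r ≤ 2 * min r K := by omega
    calc (K + m) * r ≤ (2 * m) * (2 * min r K) := Nat.mul_le_mul (by omega) this
      _ = 4 * (min r K * m) := by ring

/-- A number of blocks and a block size for which the entropy of the choice of one row out of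
each block is comparable with `J * log (e * p / J)`. -/
theorem exists_support {p J : ℕ} (hJ : 1 ≤ J) (hp : 2 * J ≤ p) :
    ∃ s b : ℕ, 0 < s ∧ 2 ≤ b ∧ s * b ≤ p ∧ s ≤ J ∧ (2 * s ≤ J ∨ (J = 1 ∧ 2 * s ≤ 2)) ∧
      J * Real.log (Real.exp 1 * p / J) ≤ 9 * (s * Real.log b) := by
  have hJ0 : (0 : ℝ) < J := by exact_mod_cast hJ
  have hp0 : (0 : ℝ) < p := by
    have : 0 < p := by omega
    exact_mod_cast this
  rcases Nat.lt_or_ge J 2 with h | h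
  · obtain rfl : J = 1 := by omega
    refine ⟨1, p, one_pos, by omega, by omega, le_rfl, .inr ⟨rfl, le_rfl⟩, ?_⟩
    have h2 : (2 : ℝ) ≤ p := by exact_mod_cast hp
    have h3 := log_exp_one_mul_le hp0 h2 le_rfl
    have h4 : 0 ≤ Real.log p := Real.log_nonneg (by linarith)
    simp only [Nat.cast_one, div_one, one_mul]
    linarith
  -- Half of `J`, so that differences keep at most `J` nonzero rows; the rounding costs `J ≤ 3 * s`.
  -- For `J = 1` this is impossible, and differences have two rows.
  · set s := J / 2 with hs
    have hs1 : 0 < s := by omega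
    have hsb : s * (p / s) ≤ p := Nat.mul_div_le p s
    have hb4 : 4 ≤ p / s := (Nat.le_div_iff_mul_le hs1).2 (by omega)
    have hlt : p < s * (p / s + 1) := Nat.lt_mul_div_succ p hs1
    have hpJ : p ≤ J * (p / s) := by
      have h1 : p ≤ s * (2 * (p / s)) := by nlinarith
      calc p ≤ s * (2 * (p / s)) := h1
        _ = (2 * s) * (p / s) := by ring
        _ ≤ J * (p / s) := Nat.mul_le_mul_right _ (by omega)
    refine ⟨s, p / s, hs1, by omega, hsb, by omega, .inl (by omega), ?_⟩
    have h2 : (2 : ℝ) ≤ ((p / s : ℕ) : ℝ) := by exact_mod_cast (by omega : 2 ≤ p / s)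
    have h3 : (p : ℝ) / J ≤ ((p / s : ℕ) : ℝ) := by
      rw [div_le_iff₀ hJ0, mul_comm]
      exact_mod_cast hpJ
    have h4 := log_exp_one_mul_le (div_pos hp0 hJ0) h2 h3
    have h5 : 0 ≤ Real.log ((p / s : ℕ) : ℝ) := Real.log_nonneg (by linarith)
    have h6 : (J : ℝ) ≤ 3 * s := by exact_mod_cast (by omega : J ≤ 3 * s)
    rw [mul_div_assoc]
    calc (J : ℝ) * Real.log (Real.exp 1 * (p / J)) ≤ J * (3 * Real.log ((p / s : ℕ) : ℝ)) := by
          gcongr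
      _ ≤ (3 * s) * (3 * Real.log ((p / s : ℕ) : ℝ)) := by gcongr
      _ = 9 * (s * Real.log ((p / s : ℕ) : ℝ)) := by ring

end MinimaxLowRank

/-! ### Assembly of the two cases -/

open MinimaxLowRank in
theorem theorem1 (l : ℝ → ℝ) (hmono : MonotoneOn l (Set.Ici 0)) (hzero : l 0 = 0)
    (hne : ∃ t : ℝ, 0 ≤ t ∧ l t ≠ 0) (δ : ℝ) (hδ : 0 < δ) :
    ∃ c c' : ℝ, 0 < c ∧ 0 < c' ∧
      ∀ (n p m J r : ℕ) (X : Matrix (Fin n) (Fin p) ℝ) (σ : ℝ), 0 < σ →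
        1 ≤ J → 2 * J ≤ p → 2 ≤ p →
        16 ≤ (r : ℝ) * (((min X.rank J : ℕ) : ℝ) + m - r) →
        1 ≤ r → 2 * r ≤ J + m → r ≤ 2 * J → r ≤ 2 * X.rank → r ≤ 2 * m →
        (J ≤ X.rank →
          (∃ κ₁ κ₂ : ℝ, 0 < κ₁ ∧ 0 < κ₂ ∧ δ ≤ κ₁ / κ₂ ∧
            MinimaxLowRank.RestrictedBounds X m J r κ₁ κ₂ ∧
            (J = 1 → ((m : ℝ) + 1 - r) * r < Real.log (Real.exp 1 * p) →
              MinimaxLowRank.RestrictedBounds X m 2 r κ₁ κ₂)) →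
          ENNReal.ofReal c' ≤
            MinimaxLowRank.minimaxRisk m J r l X σ
              (c * (σ ^ 2 * MinimaxLowRank.Po X.rank p m J r))) ∧
        (X.rank < J →
          δ ≤ MinimaxLowRank.sigmaMin X ^ 2 / MinimaxLowRank.sigmaMax X ^ 2 →
          ENNReal.ofReal c' ≤
            MinimaxLowRank.minimaxRisk m J r l X σ
              (c * (σ ^ 2 * (((X.rank : ℝ) + m - r) * r)))) := by
  obtain ⟨t, ht, hlt⟩ := hne
  have ht0 : 0 < t := lt_of_le_of_ne ht fun h => hlt (h ▸ hzero)
  have hl0 : 0 ≤ l t := hzero ▸ hmono (Set.mem_Ici.2 le_rfl) ht ht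
  have hl : 0 < l t := lt_of_le_of_ne hl0 (Ne.symm hlt)
  -- The cap at `1` is for (ii), where the ratio `κ₁ / κ₂` is `1`.
  set d : ℝ := min δ 1 with hd
  have hd0 : 0 < d := lt_min hδ one_pos
  have hlog2 := half_lt_log_two
  have hexp : Real.exp (-(Real.log 2 / 32)) < 1 := by
    rw [← Real.exp_zero]
    exact Real.exp_lt_exp.2 (by linarith)
  -- Here `18432 = 1024 * 18`, and `18 = 2 * 9`: the rate is at most twice its larger term, which is
  -- at most `9` times the entropy of the words.
  refine ⟨d / (t * 18432), l t * (1 - Real.exp (-(Real.log 2 / 32))), by positivity,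
    mul_pos hl (by linarith), ?_⟩
  intro n p m J r X σ hσ hJ hp _ h16 hr _ hrJ hrq hrm
  have hscale : ∀ {P D : ℝ}, P ≤ 18 * D →
      1024 * (t * (d / (t * 18432) * (σ ^ 2 * P))) ≤ d * (σ ^ 2 * D) := by
    intro P D h
    have h1 : 1024 * (t * (d / (t * 18432) * (σ ^ 2 * P))) = d * (σ ^ 2 * (P / 18)) := by
      field_simp
      ring
    rw [h1]
    gcongr
    linarith
  refine ⟨fun hJq ⟨κ₁, κ₂, h₁, h₂, hκ, hX, hX2⟩ => ?_, fun hqJ _ => ?_⟩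
  · have hdκ : d ≤ κ₁ / κ₂ := (min_le_left _ _).trans hκ
    rw [min_eq_right hJq] at h16
    have hJ0 : (0 : ℝ) < J := by exact_mod_cast hJ
    have hent : 0 ≤ (J : ℝ) * Real.log (Real.exp 1 * p / J) := by
      refine mul_nonneg hJ0.le (Real.log_nonneg ?_)
      rw [le_div_iff₀ hJ0, one_mul]
      have h1 : (1 : ℝ) ≤ Real.exp 1 := Real.one_le_exp (by norm_num)
      have h2 : (J : ℝ) ≤ p := by exact_mod_cast (by omega : J ≤ p)
      nlinarith
    have hPo : Po X.rank p m J r = ((J : ℝ) + m - r) * r + J * Real.log (Real.exp 1 * p / J) := by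
      rw [Po, min_eq_right hJq]
    have hPo0 : 0 < Po X.rank p m J r := by rw [hPo]; linarith
    have hS : 0 < d / (t * 18432) * (σ ^ 2 * Po X.rank p m J r) := by positivity
    rcases le_or_gt ((J : ℝ) * Real.log (Real.exp 1 * p / J)) (((J : ℝ) + m - r) * r) with h | h
    · obtain ⟨a, b, ha, hb, haJ, hbm, hab, hdim⟩ := exists_block hr hrJ hrm
      have hap : a ≤ p := by omega
      refine le_minimaxRisk_of_block hmono ht hl0 X hσ ha hb hbm hab (coordInclusion hap)
        ((numNonzeroRows_coordInclusion_le hap).trans haJ) h₁ h₂ hdκ ?_ hS ?_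
      · intro W hW
        have h3 := hX (coordInclusion hap * W) ⟨(numNonzeroRows_mul_le _ _).trans
          ((numNonzeroRows_coordInclusion_le hap).trans haJ),
          (Matrix.rank_mul_le_right _ _).trans hW⟩
        rwa [frobSq_orthonormal_mul (coordInclusion_transpose_mul hap)] at h3
      · have : 0 ≤ ((a * b : ℕ) : ℝ) * Real.log 2 := by positivity
        exact hscale (by rw [hPo]; linarith)
    · obtain ⟨s, b, hs, hb, hsb, hsJ, hsJ2, hdim⟩ := exists_support hJ hp
      refine le_minimaxRisk_of_support hmono ht hl0 X hσ hs hb hsb hsJ (by omega) hr h₁ h₂ hdκ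
        ?_ hS (hscale (by rw [hPo]; linarith))
      rcases hsJ2 with h2s | ⟨rfl, h2s⟩
      · exact hX.mono h2s
      · refine (hX2 rfl ?_).mono h2s
        simp only [Nat.cast_one, one_mul, div_one] at h
        linarith
  · rw [min_eq_left hqJ.le] at h16
    obtain ⟨a, b, ha, hb, haq, hbm, hab, hdim⟩ := exists_block hr hrq hrm
    obtain ⟨G, hG, hXG⟩ := exists_orthonormal_mul X haq
    have hP0 : 0 < ((X.rank : ℝ) + m - r) * r := by linarith
    refine le_minimaxRisk_of_block hmono ht hl0 X hσ ha hb hbm hab G (hG.trans hqJ.le)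
      one_pos one_pos ((min_le_right δ 1).trans_eq (div_one 1).symm) ?_ (by positivity) (hscale ?_)
    · intro W _
      rw [← Matrix.mul_assoc, frobSq_orthonormal_mul hXG, one_mul]
      exact ⟨le_rfl, le_rfl⟩
    · have : 0 ≤ ((a * b : ℕ) : ℝ) * Real.log 2 := by positivity
      linarith

end
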